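/- **Theorem 1.** Let $H$ be a real Hilbert space, $f\in H$, and $F(u)=B(u)-f$, where $B:H\to H$ is monotone, i.e. $\langle B(u)-B(v),u-v\rangle\ge 0$ for all $u,v$, and of class $C^2_{loc}$, i.e. $B$ is twice Fréchet differentiable and $B,B',B''$ are bounded on every ball. Assume that $F$ has a zero. Then $F$ has a unique zero $y$ of minimal norm. Let $u_0\in H$ be arbitrary, put $r=\|y\|+\|u_0\|$, and let $\rho>0$ with $\rho\ge r$ (one may take $\rho=r$ if $r>0$). Let $\varepsilon(t)=c_1(c_0+t)^{-b}$, where $c_0,c_1>0$, $b\in(0,1)$ satisfy $|\dot\varepsilon(t)|/\varepsilon(t)\le\frac14$ for $t\ge0$ and $\varepsilon(0)=4M\rho$, with $M>0$ such that $\|B''(u)\|\le M$ whenever $\|u-u_0\|\le 3\rho$; such constants $M,c_0,c_1,b$ exist. Then the following holds for every such choice. (i) $F'(u)+\varepsilon(t)I$ is boundedly invertible for all $u\in H$, $t\ge0$, and the Cauchy problem $$\dot u=-(F'(u)+\varepsilon(t)I)^{-1}[F(u)+\varepsilon(t)u],\qquad u(0)=u_0,$$ has a unique solution on $[0,\infty)$.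 It satisfies $\|u(t)-u_0\|\le 3r$ for all $t\ge 0$, and $\lim_{t\to\infty}u(t)=y$; in particular $F(\lim_{t\to\infty}u(t))=0$. (ii) For $0<\delta\le\varepsilon(0)^2/(16M)$ the equation $\varepsilon^2(t)=16M\delta$ has a unique root $t_\delta\ge 0$, and $t_\delta\to\infty$ as $\delta\to0$. If $\|f_\delta-f\|\le\delta$ for each such $\delta$, then the Cauchy problem in (i) with $F$ replaced by $F_\delta(u)=B(u)-f_\delta$ has a solution on $[0,t_\delta]$, and for any choice of solutions $u_\delta$ on $[0,t_\delta]$ one has $\lim_{\delta\to0}\|u_\delta(t_\delta)-y\|=0$. -/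

import Mathlib

open Filter Topology Set

noncomputable section

namespace DSM

variable {H : Type*} [NormedAddCommGroup H] [InnerProductSpace ℝ H]

/-- Monotone (nonlinear) operator on a real inner product space. -/
def IsMonotoneOp (B : H → H) : Prop :=
  ∀ u v : H, 0 ≤ inner ℝ (B u - B v) (u - v)

/-- The class `C²_loc`: `B` is twice Fréchet differentiable and `B`, `B'`, `B''` are bounded on every
ball. Continuity of `B''` is not required, so every `C²` map with these bounds belongs to it. -/
structure IsC2loc (B : H → H) : Prop where
  diff : Differentiable ℝ B
  diff_fderiv : Differentiable ℝ (fderiv ℝ B)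
  bound_zero : ∀ (a : H) (R : ℝ), 0 < R → ∃ M₀ : ℝ, ∀ u ∈ Metric.closedBall a R, ‖B u‖ ≤ M₀
  bound_one : ∀ (a : H) (R : ℝ), 0 < R →
    ∃ M₁ : ℝ, ∀ u ∈ Metric.closedBall a R, ‖fderiv ℝ B u‖ ≤ M₁
  bound_two : ∀ (a : H) (R : ℝ), 0 < R →
    ∃ M₂ : ℝ, ∀ u ∈ Metric.closedBall a R, ‖fderiv ℝ (fderiv ℝ B) u‖ ≤ M₂

/-- `F(u) = B(u) - f`. -/
def residual (B : H → H) (f : H) (u : H) : H := B u - f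

/-- `y` is a zero of `F` of minimal norm. -/
def IsMinNormZero (F : H → H) (y : H) : Prop :=
  F y = 0 ∧ ∀ z : H, F z = 0 → ‖y‖ ≤ ‖z‖

/-- `ε(t) = c₁ (c₀ + t)^(-b)`. -/
def eps (c₁ c₀ b t : ℝ) : ℝ := c₁ * (c₀ + t) ^ (-b)

/-- The regularized derivative `F'(u) + e I`. -/
def regDeriv (F : H → H) (e : ℝ) (u : H) : H →L[ℝ] H :=
  fderiv ℝ F u + e • ContinuousLinearMap.id ℝ H

/-- The Newton-type vector field `Φ(t, u) = -(F'(u) + ε(t) I)⁻¹ [F(u) + ε(t) u]`. -/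
def Phi (F : H → H) (ε : ℝ → ℝ) (t : ℝ) (u : H) : H :=
  -((regDeriv F (ε t) u).inverse (F u + ε t • u))

/-- `u` solves `u̇ = Φ(t, u)`, `u(0) = u₀`, on the time interval `I` (which contains `0`), with
one-sided derivatives at end points. -/
def IsSolutionOn (F : H → H) (ε : ℝ → ℝ) (u₀ : H) (I : Set ℝ) (u : ℝ → H) : Prop :=
  u 0 = u₀ ∧ ∀ t ∈ I, HasDerivWithinAt u (Phi F ε t (u t)) I t

/-- The choice of constants: `M > 0` bounds `‖B''‖` on the ball of radius `3ρ` about `u₀`,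
`c₀, c₁ > 0`, `0 < b < 1`, `|ε̇| / ε ≤ 1/4` and `ε(0) = 4 M ρ`. -/
structure Admissible (B : H → H) (u₀ : H) (ρ M c₁ c₀ b : ℝ) : Prop where
  M_pos : 0 < M
  M_bound : ∀ u ∈ Metric.closedBall u₀ (3 * ρ), ‖fderiv ℝ (fderiv ℝ B) u‖ ≤ M
  c₁_pos : 0 < c₁
  c₀_pos : 0 < c₀
  b_pos : 0 < b
  b_lt_one : b < 1
  log_deriv : ∀ t : ℝ, 0 ≤ t → |deriv (eps c₁ c₀ b) t| / eps c₁ c₀ b t ≤ 1 / 4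
  eps_zero : eps c₁ c₀ b 0 = 4 * M * ρ

end DSM

end

/-! For `e > 0` the equation `F(v) + e v = 0` has exactly one solution `V e`, because `B + e I` is
strongly monotone. As `e` decreases to `0`, `V e` converges to the zero `y` of minimal norm, and `‖V
e‖ ≤ ‖y‖` throughout. It remains to show that the trajectory tracks the moving point `V (ε t)`.

Put `w = u - V (ε t)`. A Newton step from `u` equals `w` up to an error: the inverse of `F'(u) + ε
I`, of norm at most `1/ε`, applied to a Taylor remainder plus the data error. The path itself drifts
at speed at most `b / (c₀ + t) * ‖y‖`. Hence, formally, `‖w‖' ≤ -‖w‖ + (M/2 ‖w‖² + δ) / ε + b / (c₀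
+ t) * ‖y‖`.

The constants are chosen so that `ε / (4 M)` is a barrier for this inequality as long as `16 M δ ≤
ε²` (`norm_sub_regularized_le`); it starts at `ρ` since `ε(0) = 4 M ρ`. This single bound keeps the
trajectory in the ball where `M` is valid, gives global existence by a cut-off argument, and forces
`w → 0`, also at the stopping time. A second, constant barrier (`norm_sub_regularized_le_init`)
localizes the exact trajectory in terms of `‖y‖ + ‖u₀‖` instead of `ρ`. -/

namespace DSM

/-! ### Calculus and ODE tools in normed spaces -/

section General

/-- The quadratic Taylor estimate on a convex set where the second derivative is bounded. -/
theorem norm_taylor_two_le {E : Type*} [NormedAddCommGroup E] [NormedSpace ℝ E]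
    {G : E → E} (h1 : Differentiable ℝ G) (h2 : Differentiable ℝ (fderiv ℝ G))
    {s : Set E} (hs : Convex ℝ s) {M : ℝ}
    (hM : ∀ x ∈ s, ‖fderiv ℝ (fderiv ℝ G) x‖ ≤ M) {u v : E} (hu : u ∈ s) (hv : v ∈ s) :
    ‖G v - G u - fderiv ℝ G u (v - u)‖ ≤ M / 2 * ‖v - u‖ ^ 2 := by
  set h := v - u with hh
  have hline : ∀ t : ℝ, HasDerivAt (fun t : ℝ => u + t • h) h t := fun t => by
    simpa using ((hasDerivAt_id t).smul_const h).const_add u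
  have hder : ∀ t : ℝ, HasDerivAt (fun t : ℝ => G (u + t • h) - G u - t • fderiv ℝ G u h)
      (fderiv ℝ G (u + t • h) h - fderiv ℝ G u h) t := fun t => by
    have a := (h1 (u + t • h)).hasFDerivAt.comp_hasDerivAt t (hline t)
    have b := (hasDerivAt_id t).smul_const (fderiv ℝ G u h)
    simpa using (a.sub_const (G u)).fun_sub b
  have hmem : ∀ t ∈ Icc (0 : ℝ) 1, u + t • h ∈ s := fun t ht => by
    have := hs hu hv (sub_nonneg.2 ht.2) ht.1 (by ring)
    convert this using 1
    rw [hh]; module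
  -- Compare the remainder along the segment with `M / 2 * ‖h‖ ^ 2 * t ^ 2`; its derivative is
  -- bounded by the mean value inequality for `fderiv ℝ G`.
  have key := image_norm_le_of_norm_deriv_right_le_deriv_boundary (a := 0) (b := 1)
    (f := fun t : ℝ => G (u + t • h) - G u - t • fderiv ℝ G u h)
    (f' := fun t => fderiv ℝ G (u + t • h) h - fderiv ℝ G u h)
    (fun t _ => (hder t).continuousAt.continuousWithinAt)
    (fun t _ => (hder t).hasDerivWithinAt)
    (B := fun t => M / 2 * ‖h‖ ^ 2 * t ^ 2) (B' := fun t => M * ‖h‖ ^ 2 * t) (by simp)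
    (fun t => by
      refine ((hasDerivAt_pow 2 t).const_mul (M / 2 * ‖h‖ ^ 2)).congr_deriv ?_
      push_cast; ring)
    (fun t ht => by
      have b := hs.norm_image_sub_le_of_norm_fderiv_le (fun x _ => h2 x) hM hu
        (hmem t ⟨ht.1, ht.2.le⟩)
      rw [add_sub_cancel_left, norm_smul, Real.norm_of_nonneg ht.1] at b
      rw [← sub_apply]
      calc _ ≤ ‖fderiv ℝ G (u + t • h) - fderiv ℝ G u‖ * ‖h‖ :=
            ContinuousLinearMap.le_opNorm _ _
        _ ≤ M * (t * ‖h‖) * ‖h‖ := by gcongr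
        _ = _ := by ring)
  have := key (right_mem_Icc.2 zero_le_one)
  simpa [hh] using this

/-- A Lipschitz retraction of a normed space onto a closed ball. -/
theorem exists_lipschitz_retraction_closedBall {E : Type*} [NormedAddCommGroup E]
    [NormedSpace ℝ E] (c : E) {R : ℝ} (hR : 0 < R) :
    ∃ P : E → E, LipschitzWith 2 P ∧ (∀ x, P x ∈ Metric.closedBall c R) ∧
      ∀ x ∈ Metric.closedBall c R, P x = x := by
  -- Radial projection. The constant `2` comes from splitting the difference into a change of point
  -- and a change of scaling factor.
  refine ⟨fun x => c + (R / max R ‖x - c‖) • (x - c), ?_, ?_, ?_⟩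
  · refine LipschitzWith.of_dist_le_mul fun x y => ?_
    set a := max R ‖x - c‖ with ha
    set b := max R ‖y - c‖ with hb
    have ha0 : 0 < a := lt_max_of_lt_left hR
    have hb0 : 0 < b := lt_max_of_lt_left hR
    have e : c + (R / a) • (x - c) - (c + (R / b) • (y - c)) =
        (R / a) • (x - y) + (R / a * ((b - a) / b)) • (y - c) := by
      have h1 : R / a * ((b - a) / b) = R / a - R / b := by field_simp
      rw [h1]; module
    have hRa : R / a ≤ 1 := (div_le_one ha0).2 (le_max_left _ _)
    have hRa0 : 0 ≤ R / a := by positivity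
    have hab : |b - a| ≤ ‖x - y‖ := by
      have h1 : |b - a| ≤ |‖y - c‖ - ‖x - c‖| := by
        have := abs_max_sub_max_le_max R ‖y - c‖ R ‖x - c‖
        simpa using this
      have h2 := abs_norm_sub_norm_le (y - c) (x - c)
      rw [sub_sub_sub_cancel_right, norm_sub_rev y x] at h2
      exact h1.trans h2
    rw [dist_eq_norm, dist_eq_norm, e]
    calc _ ≤ ‖(R / a) • (x - y)‖ + ‖(R / a * ((b - a) / b)) • (y - c)‖ := norm_add_le _ _
      _ = R / a * ‖x - y‖ + R / a * (|b - a| * (‖y - c‖ / b)) := by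
        rw [norm_smul, norm_smul, Real.norm_of_nonneg hRa0, norm_mul, Real.norm_of_nonneg hRa0,
          norm_div, Real.norm_of_nonneg hb0.le, Real.norm_eq_abs]
        ring
      _ ≤ 1 * ‖x - y‖ + 1 * (‖x - y‖ * 1) := by
        have : ‖y - c‖ / b ≤ 1 := (div_le_one hb0).2 (le_max_right _ _)
        gcongr
      _ = _ := by norm_num; ring
  · intro x
    have ha0 : 0 < max R ‖x - c‖ := lt_max_of_lt_left hR
    rw [mem_closedBall_iff_norm, add_sub_cancel_left, norm_smul, norm_div,
      Real.norm_of_nonneg hR.le, Real.norm_of_nonneg ha0.le, div_mul_eq_mul_div, div_le_iff₀ ha0]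
    gcongr
    exact le_max_right _ _
  · intro x hx
    rw [mem_closedBall_iff_norm] at hx
    simp only
    rw [max_eq_left hx, div_self hR.ne']
    simp

/-- Global existence on a compact interval for a bounded, globally Lipschitz vector field. -/
theorem exists_solution_of_bounded_lipschitz {E : Type*} [NormedAddCommGroup E]
    [NormedSpace ℝ E] [CompleteSpace E] {g : ℝ → E → E} {T L K : ℝ} (hT : 0 ≤ T)
    (hlip : ∀ t ∈ Icc 0 T, ∀ x y, ‖g t x - g t y‖ ≤ K * ‖x - y‖)
    (hcont : ∀ x, ContinuousOn (fun t => g t x) (Icc 0 T))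
    (hbd : ∀ t ∈ Icc 0 T, ∀ x, ‖g t x‖ ≤ L) (x₀ : E) :
    ∃ u : ℝ → E, u 0 = x₀ ∧ ∀ t ∈ Icc 0 T, HasDerivWithinAt u (g t (u t)) (Icc 0 T) t := by
  have hL : 0 ≤ L := (norm_nonneg _).trans (hbd 0 ⟨le_rfl, hT⟩ x₀)
  -- The bounds hold on all of `E`, so the radius is free; `L * T` is the distance a solution can
  -- travel.
  have : IsPicardLindelof g (⟨0, le_rfl, hT⟩ : Icc (0 : ℝ) T) x₀
      (⟨L * T, by positivity⟩ : NNReal) 0 ⟨L, hL⟩ K.toNNReal :=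
    { lipschitzOnWith := fun t ht => LipschitzOnWith.of_dist_le_mul fun x _ y _ => by
        rw [dist_eq_norm, dist_eq_norm]
        refine (hlip t ht x y).trans ?_
        gcongr
        exact Real.le_coe_toNNReal K
      continuousOn := fun x _ => hcont x
      norm_le := fun t ht x _ => hbd t ht x
      mul_max_le := by
        change L * max (T - 0) (0 - 0) ≤ L * T - 0
        rw [sub_zero, sub_zero, sub_zero, max_eq_left hT] }
  exact this.exists_eq_forall_mem_Icc_hasDerivWithinAt₀

end General

/-! ### Monotone operators and the regularized equation -/

section Operator

variable {H : Type*} [NormedAddCommGroup H] [InnerProductSpace ℝ H]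

theorem fderiv_residual (B : H → H) (f u : H) :
    fderiv ℝ (residual B f) u = fderiv ℝ B u := by
  unfold residual
  exact fderiv_sub_const f

theorem regDeriv_residual (B : H → H) (f : H) (e : ℝ) (u : H) :
    regDeriv (residual B f) e u = regDeriv B e u := by
  simp only [regDeriv, fderiv_residual]

theorem regDeriv_apply (B : H → H) (e : ℝ) (u x : H) :
    regDeriv B e u x = fderiv ℝ B u x + e • x := by
  simp [regDeriv]

/-- The difference quotients of `B` in direction `x`, paired with `x`, are nonnegative by
monotonicity; pass to the limit. -/
theorem IsMonotoneOp.inner_fderiv_nonneg {B : H → H} (hB : IsMonotoneOp B)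
    {u : H} (hd : DifferentiableAt ℝ B u) (x : H) : 0 ≤ inner ℝ (fderiv ℝ B u x) x := by
  have h1 : HasDerivAt (fun s : ℝ => u + s • x) x 0 := by
    simpa using ((hasDerivAt_id (0 : ℝ)).smul_const x).const_add u
  have h2 : HasDerivAt (fun s : ℝ => B (u + s • x)) (fderiv ℝ B u x) 0 := by
    have h3 : HasFDerivAt B (fderiv ℝ B u) (u + (0 : ℝ) • x) := by simpa using hd.hasFDerivAt
    exact h3.comp_hasDerivAt 0 h1
  have h4 := h2.tendsto_slope_zero_right
  have h5 := h4.inner (𝕜 := ℝ) (tendsto_const_nhds (x := x))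
  refine ge_of_tendsto h5 ?_
  filter_upwards [self_mem_nhdsWithin] with s hs
  have hs : 0 < s := hs
  have h6 := hB (u + s • x) u
  rw [add_sub_cancel_left, real_inner_smul_right] at h6
  have h7 : 0 ≤ inner ℝ (B (u + s • x) - B u) x := nonneg_of_mul_nonneg_right h6 hs
  simp only [zero_add, zero_smul, add_zero, real_inner_smul_left]
  positivity

theorem IsMonotoneOp.mul_sq_norm_le_inner {B : H → H} (hB : IsMonotoneOp B) (e : ℝ) (u v : H) :
    e * ‖u - v‖ ^ 2 ≤ inner ℝ (B u + e • u - (B v + e • v)) (u - v) := by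
  have h := hB u v
  have : B u + e • u - (B v + e • v) = (B u - B v) + e • (u - v) := by module
  rw [this, inner_add_left, real_inner_smul_left, real_inner_self_eq_norm_sq]
  linarith

theorem IsMonotoneOp.mul_norm_le {B : H → H} (hB : IsMonotoneOp B) (e : ℝ) (u v : H) :
    e * ‖u - v‖ ≤ ‖B u + e • u - (B v + e • v)‖ := by
  rcases (norm_nonneg (u - v)).eq_or_lt with h | h
  · rw [← h, mul_zero]; positivity
  · have h1 := (hB.mul_sq_norm_le_inner e u v).trans (real_inner_le_norm _ _)
    rw [pow_two, ← mul_assoc] at h1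
    exact le_of_mul_le_mul_right h1 h

theorem IsMonotoneOp.mul_norm_le_regDeriv {B : H → H} (hB : IsMonotoneOp B) (e : ℝ) {u : H}
    (hd : DifferentiableAt ℝ B u) (x : H) : e * ‖x‖ ≤ ‖regDeriv B e u x‖ := by
  rcases (norm_nonneg x).eq_or_lt with h | h
  · rw [← h, mul_zero]; positivity
  · have h1 := real_inner_le_norm (regDeriv B e u x) x
    rw [regDeriv_apply, inner_add_left, real_inner_smul_left, real_inner_self_eq_norm_sq] at h1
    have h2 := hB.inner_fderiv_nonneg hd x
    rw [regDeriv_apply]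
    have h3 : (e * ‖x‖) * ‖x‖ ≤ ‖fderiv ℝ B u x + e • x‖ * ‖x‖ := by nlinarith
    exact le_of_mul_le_mul_right h3 h

variable [CompleteSpace H]

/-- Lax–Milgram: the quadratic form of `regDeriv B e u` is at least `e ‖x‖²`. -/
theorem IsMonotoneOp.isInvertible_regDeriv {B : H → H} (hB : IsMonotoneOp B) {e : ℝ}
    (he : 0 < e) {u : H} (hd : DifferentiableAt ℝ B u) : (regDeriv B e u).IsInvertible := by
  have hU : IsUnit (regDeriv B e u) := by
    refine ContinuousLinearMap.isUnit_of_forall_le_norm_inner_map _ (c := ⟨e, he.le⟩) he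
      fun x => ?_
    rw [regDeriv_apply, inner_add_left, real_inner_smul_left, real_inner_self_eq_norm_sq]
    have h2 := hB.inner_fderiv_nonneg hd x
    refine le_trans ?_ (le_abs_self _)
    change ‖x‖ ^ 2 * e ≤ _
    linarith
  obtain ⟨w, hw⟩ := hU
  exact ⟨ContinuousLinearEquiv.unitsEquiv ℝ H w, by rw [← hw]; rfl⟩

theorem IsMonotoneOp.mul_norm_inverse_le {B : H → H} (hB : IsMonotoneOp B) {e : ℝ}
    (he : 0 < e) {u : H} (hd : DifferentiableAt ℝ B u) (z : H) :
    e * ‖(regDeriv B e u).inverse z‖ ≤ ‖z‖ := by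
  have h := hB.mul_norm_le_regDeriv e hd ((regDeriv B e u).inverse z)
  rwa [(hB.isInvertible_regDeriv he hd).self_apply_inverse] at h

theorem IsMonotoneOp.norm_inverse_le {B : H → H} (hB : IsMonotoneOp B) {e : ℝ}
    (he : 0 < e) {u : H} (hd : DifferentiableAt ℝ B u) (z : H) :
    ‖(regDeriv B e u).inverse z‖ ≤ ‖z‖ / e := by
  rw [le_div_iff₀ he, mul_comm]
  exact hB.mul_norm_inverse_le he hd z

/-- Solvability of the regularized equation. -/
theorem exists_regularized_solution {B : H → H} (hB : IsMonotoneOp B) (hC : IsC2loc B) {e : ℝ}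
    (he : 0 < e) (f : H) : ∃ v : H, residual B f v + e • v = 0 := by
  -- The range of `G` is open by the inverse function theorem and closed because strong monotonicity
  -- makes preimages of Cauchy sequences Cauchy. As `H` is connected, it is everything.
  set G : H → H := fun v => B v + e • v with hG
  have hGd : ∀ v, HasFDerivAt G (regDeriv B e v) v := fun v =>
    (hC.diff v).hasFDerivAt.add ((hasFDerivAt_id v).const_smul e)
  have hcont : Continuous G := continuous_iff_continuousAt.2 fun v => (hGd v).continuousAt
  have hopen : IsOpenMap G := by
    refine isOpenMap_iff_nhds_le.2 fun v => ?_
    obtain ⟨A, hA⟩ := hB.isInvertible_regDeriv he (hC.diff v)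
    have hs : HasStrictFDerivAt G (A : H →L[ℝ] H) v := by
      rw [hA]
      refine hasStrictFDerivAt_of_hasFDerivAt_of_continuousAt (Eventually.of_forall hGd) ?_
      exact (hC.diff_fderiv v).continuousAt.add continuousAt_const
    exact hs.map_nhds_eq_of_equiv.ge
  have hclosed : IsClosed (range G) := by
    refine IsSeqClosed.isClosed fun x z hx hz => ?_
    choose w hw using hx
    have hc : CauchySeq w := by
      refine Metric.cauchySeq_iff'.2 fun η hη => ?_
      obtain ⟨N, hN⟩ := Metric.cauchySeq_iff'.1 hz.cauchySeq (e * η) (by positivity)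
      refine ⟨N, fun n hn => ?_⟩
      have h1 := hN n hn
      rw [← hw, ← hw, dist_eq_norm] at h1
      rw [dist_eq_norm]
      exact lt_of_mul_lt_mul_left ((hB.mul_norm_le e _ _).trans_lt h1) he.le
    obtain ⟨l, hl⟩ := cauchySeq_tendsto_of_complete hc
    refine ⟨l, tendsto_nhds_unique ((hcont.tendsto l).comp hl) ?_⟩
    exact hz.congr fun n => (hw n).symm
  have huniv : range G = univ :=
    IsClopen.eq_univ ⟨hclosed, hopen.isOpen_range⟩ (range_nonempty G)
  obtain ⟨v, hv⟩ : f ∈ range G := huniv ▸ mem_univ f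
  refine ⟨v, ?_⟩
  rw [residual, ← hv, hG]
  module

end Operator

end DSM

namespace DSM

/-! ### The path of regularized solutions -/

section RegularizedPath

variable {H : Type*} [NormedAddCommGroup H] [InnerProductSpace ℝ H]
  {B : H → H} {f : H}

theorem residual_add_smul_sub (B : H → H) (f u v : H) (e : ℝ) :
    residual B f u + e • u - (residual B f v + e • v) = B u + e • u - (B v + e • v) := by
  simp only [residual]; abel

theorem apply_regularized {e : ℝ} {v : H} (hv : residual B f v + e • v = 0) :
    B v = f - e • v := by
  have h : B v - f = -(e • v) := eq_neg_of_add_eq_zero_left hv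
  rw [sub_eq_iff_eq_add.1 h]; abel

theorem sq_norm_regularized_le_inner (hB : IsMonotoneOp B) {e : ℝ} (he : 0 < e) {v z : H}
    (hv : residual B f v + e • v = 0) (hz : residual B f z = 0) :
    ‖v‖ ^ 2 ≤ inner ℝ v z := by
  have h := hB v z
  have h1 : B v - B z = -(e • v) := by
    have h3 : B z = f := sub_eq_zero.1 hz
    rw [apply_regularized hv, h3]; abel
  rw [h1, inner_neg_left, real_inner_smul_left, inner_sub_right, real_inner_self_eq_norm_sq] at h
  nlinarith

theorem norm_regularized_le (hB : IsMonotoneOp B) {e : ℝ} (he : 0 < e) {v z : H}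
    (hv : residual B f v + e • v = 0) (hz : residual B f z = 0) : ‖v‖ ≤ ‖z‖ := by
  have h := (sq_norm_regularized_le_inner hB he hv hz).trans (real_inner_le_norm v z)
  rcases (norm_nonneg v).eq_or_lt with h0 | h0
  · rw [← h0]; exact norm_nonneg z
  · rw [pow_two] at h
    exact le_of_mul_le_mul_left h h0

theorem mul_norm_regularized_sub_le (hB : IsMonotoneOp B) {e s : ℝ} {v w : H}
    (hv : residual B f v + e • v = 0) (hw : residual B f w + s • w = 0) :
    e * ‖v - w‖ ≤ |e - s| * ‖w‖ := by
  have h := hB.mul_norm_le e v w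
  rw [← residual_add_smul_sub B f, hv] at h
  have : (0 : H) - (residual B f w + e • w) = -((e - s) • w) := by
    rw [← hw]; module
  rwa [this, norm_neg, norm_smul, Real.norm_eq_abs] at h

/-- Monotonicity forces `⟪w, v - w⟫ ≥ 0`; expand `‖(v - w) + w‖²`. Thus norms grow as the parameter
decreases, and their increments control distances, which gives the Cauchy property at `0`. -/
theorem sq_norm_regularized_sub_le (hB : IsMonotoneOp B) {e s : ℝ} (he : 0 < e) (hes : e < s)
    {v w : H} (hv : residual B f v + e • v = 0) (hw : residual B f w + s • w = 0) :
    ‖v - w‖ ^ 2 ≤ ‖v‖ ^ 2 - ‖w‖ ^ 2 := by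
  have h := hB.mul_sq_norm_le_inner e v w
  rw [← residual_add_smul_sub B f, hv] at h
  have : (0 : H) - (residual B f w + e • w) = (s - e) • w := by
    rw [← hw]; module
  rw [this, real_inner_smul_left] at h
  have h1 : 0 ≤ inner ℝ w (v - w) := by
    have : 0 ≤ (s - e) * inner ℝ w (v - w) := le_trans (by positivity) h
    exact nonneg_of_mul_nonneg_right this (sub_pos.2 hes)
  have h2 : v = (v - w) + w := by abel
  have h3 : ‖v‖ ^ 2 = ‖v - w‖ ^ 2 + 2 * inner ℝ w (v - w) + ‖w‖ ^ 2 := by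
    conv_lhs => rw [h2]
    rw [norm_add_sq_real, real_inner_comm]
  linarith

variable [CompleteSpace H]

/-- The regularized solutions converge to a zero of minimal norm, which is unique. -/
theorem tendsto_regularized (hB : IsMonotoneOp B) (hc : Continuous B)
    (hN : ∃ z : H, residual B f z = 0) {V : ℝ → H}
    (hV : ∀ e, 0 < e → residual B f (V e) + e • V e = 0) :
    ∃ y : H, Tendsto V (𝓝[>] 0) (𝓝 y) ∧ IsMinNormZero (residual B f) y ∧
      ∀ y' : H, IsMinNormZero (residual B f) y' → y' = y := by
  obtain ⟨z, hz⟩ := hN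
  have hcau : Cauchy (map V (𝓝[>] 0)) := by
    refine Metric.cauchy_iff.2 ⟨inferInstance, fun η hη => ?_⟩
    set N : Set ℝ := (fun e => ‖V e‖ ^ 2) '' Ioi 0 with hNdef
    have hbdd : BddAbove N := by
      refine ⟨‖z‖ ^ 2, ?_⟩
      rintro _ ⟨e, he, rfl⟩
      have := norm_regularized_le hB he (hV e he) hz
      simp only
      gcongr
    have hne : N.Nonempty := ⟨_, 1, mem_Ioi.2 one_pos, rfl⟩
    -- Once `‖V s‖²` is within `(η/2)²` of its supremum, all `V e` with `e < s` lie within `η/2` of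
    -- `V s`.
    obtain ⟨_, ⟨s, hs, rfl⟩, hs'⟩ := exists_lt_of_lt_csSup hne
      (show sSup N - (η / 2) ^ 2 < sSup N by have : 0 < (η / 2) ^ 2 := by positivity
                                             linarith)
    have hclose : ∀ e ∈ Ioo 0 s, dist (V e) (V s) < η / 2 := fun e he => by
      have h1 := sq_norm_regularized_sub_le hB he.1 he.2 (hV e he.1) (hV s hs)
      have h2 : ‖V e‖ ^ 2 ≤ sSup N := le_csSup hbdd ⟨e, he.1, rfl⟩
      rw [dist_eq_norm]
      refine lt_of_pow_lt_pow_left₀ 2 (by positivity) ?_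
      simp only at hs'
      linarith
    refine ⟨V '' Ioo 0 s, image_mem_map (Ioo_mem_nhdsGT hs), ?_⟩
    rintro _ ⟨a, ha, rfl⟩ _ ⟨b, hb, rfl⟩
    have := dist_triangle_right (V a) (V b) (V s)
    linarith [hclose a ha, hclose b hb]
  obtain ⟨y, hy⟩ := CompleteSpace.complete hcau
  have hy : Tendsto V (𝓝[>] 0) (𝓝 y) := hy
  have hid : Tendsto (fun e : ℝ => e) (𝓝[>] 0) (𝓝 0) := nhdsWithin_le_nhds
  have hy0 : residual B f y = 0 := by
    have h1 : Tendsto (fun e => residual B f (V e) + e • V e) (𝓝[>] 0)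
        (𝓝 (residual B f y + (0 : ℝ) • y)) :=
      (((hc.tendsto y).comp hy).sub_const f).add (hid.smul hy)
    have h2 : Tendsto (fun e => residual B f (V e) + e • V e) (𝓝[>] 0) (𝓝 0) := by
      refine tendsto_const_nhds.congr' ?_
      filter_upwards [self_mem_nhdsWithin] with e he
      exact (hV e he).symm
    simpa using tendsto_nhds_unique h1 h2
  -- This variational inequality gives uniqueness: it makes `‖y' - y‖² ≤ ‖y'‖² - ‖y‖²` for every
  -- zero `y'`.
  have hin : ∀ z', residual B f z' = 0 → ‖y‖ ^ 2 ≤ inner ℝ y z' := fun z' hz' => by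
    refine le_of_tendsto_of_tendsto (hy.norm.pow 2) (hy.inner tendsto_const_nhds) ?_
    filter_upwards [self_mem_nhdsWithin] with e he
    exact sq_norm_regularized_le_inner hB he (hV e he) hz'
  refine ⟨y, hy, ⟨hy0, fun z' hz' => ?_⟩, fun y' hy' => ?_⟩
  · refine le_of_tendsto hy.norm ?_
    filter_upwards [self_mem_nhdsWithin] with e he
    exact norm_regularized_le hB he (hV e he) hz'
  · have h1 := hin y' hy'.1
    have h2 := hy'.2 y hy0
    have h3 := norm_sub_sq_real y' y
    rw [real_inner_comm] at h3
    have h4 : ‖y'‖ ^ 2 ≤ ‖y‖ ^ 2 := by gcongr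
    have h5 : ‖y' - y‖ ^ 2 ≤ 0 := by linarith
    have h6 : ‖y' - y‖ = 0 := by
      have := le_antisymm h5 (by positivity)
      simpa using this
    exact sub_eq_zero.1 (norm_eq_zero.1 h6)

/-- The regularized solution is differentiable in the regularization parameter. -/
theorem hasDerivAt_regularized (hB : IsMonotoneOp B) (hd : Differentiable ℝ B) {V : ℝ → H}
    (hV : ∀ e, 0 < e → residual B f (V e) + e • V e = 0) {e : ℝ} (he : 0 < e) :
    HasDerivAt V (-((regDeriv B e (V e)).inverse (V e))) e := by
  -- Monotonicity already makes the path Lipschitz at `e`, so no implicit function theorem is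
  -- needed; `s > e / 2` fixes the constant.
  have hO : (fun s => V s - V e) =O[𝓝 e] fun s => s - e := by
    refine Asymptotics.IsBigO.of_bound (2 / e * ‖V e‖) ?_
    filter_upwards [lt_mem_nhds (half_lt_self he)] with s hs
    have hs0 : 0 < s := (half_pos he).trans hs
    have h := mul_norm_regularized_sub_le hB (hV s hs0) (hV e he)
    rw [Real.norm_eq_abs]
    have h1 : e / 2 * ‖V s - V e‖ ≤ |s - e| * ‖V e‖ := le_trans (by gcongr) h
    calc ‖V s - V e‖ = 2 / e * (e / 2 * ‖V s - V e‖) := by field_simp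
      _ ≤ 2 / e * (|s - e| * ‖V e‖) := by gcongr
      _ = _ := by ring
  have hlim : Tendsto V (𝓝 e) (𝓝 (V e)) := by
    have h0 : Tendsto (fun s : ℝ => s - e) (𝓝 e) (𝓝 0) := by
      have : Continuous fun s : ℝ => s - e := by fun_prop
      simpa using this.tendsto e
    simpa using (hO.trans_tendsto h0).add_const (V e)
  have ho : (fun s => B (V s) - B (V e) - fderiv ℝ B (V e) (V s - V e)) =o[𝓝 e]
      fun s => s - e := by
    have := (hasFDerivAt_iff_isLittleO.1 (hd (V e)).hasFDerivAt).comp_tendsto hlim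
    exact this.trans_isBigO hO
  have ho2 : (fun s => (s - e) • (V s - V e)) =o[𝓝 e] fun s => s - e := by
    have h1 : (fun s => V s - V e) =o[𝓝 e] fun _ => (1 : ℝ) := by
      rw [Asymptotics.isLittleO_one_iff]
      simpa using hlim.sub_const (V e)
    simpa using (Asymptotics.isBigO_refl (fun s : ℝ => s - e) (𝓝 e)).smul_isLittleO h1
  rw [hasDerivAt_iff_isLittleO]
  have hinv := hB.isInvertible_regDeriv he (hd (V e))
  -- Subtracting the equations for `V s` and `V e` shows that `regDeriv B e (V e)` maps the
  -- linearization error to exactly this negated sum.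
  have hmain := ((regDeriv B e (V e)).inverse.isBigO_comp
    (fun s => -((B (V s) - B (V e) - fderiv ℝ B (V e) (V s - V e)) + (s - e) • (V s - V e)))
    (𝓝 e)).trans_isLittleO (ho.add ho2).neg_left
  refine hmain.congr' ?_ EventuallyEq.rfl
  filter_upwards [lt_mem_nhds he] with s hs
  apply hinv.injective
  rw [hinv.self_apply_inverse, map_sub (regDeriv B e (V e)), map_smul (regDeriv B e (V e)),
    map_neg (regDeriv B e (V e)), hinv.self_apply_inverse, regDeriv_apply]
  rw [apply_regularized (hV s hs), apply_regularized (hV e he)]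
  module

end RegularizedPath

end DSM

noncomputable section

namespace DSM

/-! ### The regularization parameter -/

section Gauge

variable {c₁ c₀ b : ℝ}

theorem eps_pos (h₁ : 0 < c₁) (h₀ : 0 < c₀) {t : ℝ} (ht : 0 ≤ t) : 0 < eps c₁ c₀ b t :=
  mul_pos h₁ (Real.rpow_pos_of_pos (by linarith) _)

theorem hasDerivAt_eps (h₀ : 0 < c₀) {t : ℝ} (ht : 0 ≤ t) :
    HasDerivAt (eps c₁ c₀ b) (-(b / (c₀ + t) * eps c₁ c₀ b t)) t := by
  have hp : 0 < c₀ + t := by linarith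
  have h := (((hasDerivAt_id t).const_add c₀).rpow_const (p := -b)
    (Or.inl hp.ne')).const_mul c₁
  refine h.congr_deriv ?_
  simp only [id, eps]
  rw [Real.rpow_sub_one hp.ne']
  field_simp

theorem eps_strictAntiOn (h₁ : 0 < c₁) (h₀ : 0 < c₀) (hb : 0 < b) :
    StrictAntiOn (eps c₁ c₀ b) (Ici 0) := fun s hs t _ hst => by
  have hs : 0 ≤ s := hs
  refine mul_lt_mul_of_pos_left ?_ h₁
  exact Real.rpow_lt_rpow_of_neg (by linarith) (by linarith) (by linarith)

theorem tendsto_eps (h₁ : 0 < c₁) (h₀ : 0 < c₀) (hb : 0 < b) :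
    Tendsto (eps c₁ c₀ b) atTop (𝓝[>] 0) := by
  refine tendsto_nhdsWithin_iff.2 ⟨?_, ?_⟩
  · have h := ((tendsto_rpow_neg_atTop hb).comp (tendsto_atTop_add_const_left atTop c₀
      tendsto_id)).const_mul c₁
    rw [mul_zero] at h
    exact h
  · filter_upwards [eventually_ge_atTop 0] with t ht
    exact eps_pos h₁ h₀ ht

variable {H : Type*} [NormedAddCommGroup H] [InnerProductSpace ℝ H] {B : H → H} {u₀ : H}
  {ρ M : ℝ}

theorem Admissible.rate_le (hA : Admissible B u₀ ρ M c₁ c₀ b) {t : ℝ} (ht : 0 ≤ t) :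
    b / (c₀ + t) ≤ 1 / 4 := by
  have h := hA.log_deriv t ht
  have he := eps_pos (b := b) hA.c₁_pos hA.c₀_pos ht
  have hp : 0 ≤ b / (c₀ + t) := div_nonneg hA.b_pos.le (by linarith [hA.c₀_pos])
  rwa [(hasDerivAt_eps hA.c₀_pos ht).deriv, abs_neg, abs_mul, abs_of_pos he, abs_of_nonneg hp,
    mul_div_assoc, div_self he.ne', mul_one] at h

theorem Admissible.rate_nonneg (hA : Admissible B u₀ ρ M c₁ c₀ b) {t : ℝ} (ht : 0 ≤ t) :
    0 ≤ b / (c₀ + t) :=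
  div_nonneg hA.b_pos.le (by linarith [hA.c₀_pos])

/-- At `t = 0` this is `b / c₀ ≤ 1 / 4` combined with `ε(0) = 4 M ρ`. It persists because `b < 1`
makes `1 / (c₀ + t)` decay faster than `ε`. -/
theorem Admissible.rate_mul_le (hA : Admissible B u₀ ρ M c₁ c₀ b) (hρ : 0 ≤ ρ) {t : ℝ}
    (ht : 0 ≤ t) : b / (c₀ + t) * ρ ≤ eps c₁ c₀ b t / (16 * M) := by
  have h0 := hA.c₀_pos
  have hM := hA.M_pos
  have hp : 0 < c₀ + t := by linarith
  have hz : c₁ * c₀ ^ (-b) = 4 * M * ρ := by simpa [eps] using hA.eps_zero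
  have hr : b / c₀ ≤ 1 / 4 := by simpa using hA.rate_le le_rfl
  have hpow : c₀ ^ (-b) * (c₀ / (c₀ + t)) ≤ (c₀ + t) ^ (-b) := by
    have h1 : c₀ ^ (1 - b) ≤ (c₀ + t) ^ (1 - b) :=
      Real.rpow_le_rpow h0.le (by linarith) (by linarith [hA.b_lt_one])
    rw [sub_eq_add_neg, Real.rpow_add h0, Real.rpow_add hp, Real.rpow_one, Real.rpow_one] at h1
    rw [mul_div_assoc', div_le_iff₀ hp]
    linarith
  rw [le_div_iff₀ (by positivity)]
  calc b / (c₀ + t) * ρ * (16 * M) = b / c₀ * (4 * (4 * M * ρ)) * (c₀ / (c₀ + t)) := by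
        field_simp; ring
    _ ≤ 1 / 4 * (4 * (4 * M * ρ)) * (c₀ / (c₀ + t)) := by gcongr
    _ = c₁ * (c₀ ^ (-b) * (c₀ / (c₀ + t))) := by rw [← hz]; ring
    _ ≤ c₁ * (c₀ + t) ^ (-b) := by have := hA.c₁_pos; gcongr

end Gauge

/-! ### The Newton vector field -/

section VectorField

variable {H : Type*} [NormedAddCommGroup H] [InnerProductSpace ℝ H]
  {B : H → H} {f g : H}

/-- The regularized Newton step `(B'(u) + e I)⁻¹ [B(u) - g + e u]`. -/
def newtonStep (B : H → H) (g : H) (e : ℝ) (u : H) : H :=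
  (regDeriv B e u).inverse (residual B g u + e • u)

theorem Phi_residual (B : H → H) (g : H) (ε : ℝ → ℝ) (t : ℝ) (u : H) :
    Phi (residual B g) ε t u = -newtonStep B g (ε t) u := by
  rw [Phi, regDeriv_residual, newtonStep]

variable [CompleteSpace H]

/-- Resolvent identity `A⁻¹ h - C⁻¹ k = A⁻¹ (h - k + (C - A) C⁻¹ k)`. It yields both continuity in
the parameter and Lipschitz continuity in space. -/
theorem IsMonotoneOp.norm_inverse_sub_inverse_le (hB : IsMonotoneOp B)
    (hd : Differentiable ℝ B) {e s : ℝ} (he : 0 < e) (hs : 0 < s) (u v h k : H) :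
    ‖(regDeriv B e u).inverse h - (regDeriv B s v).inverse k‖ ≤
      (‖h - k‖ + ‖regDeriv B s v - regDeriv B e u‖ * (‖k‖ / s)) / e := by
  have h1 := hB.isInvertible_regDeriv he (hd u)
  have h2 := hB.isInvertible_regDeriv hs (hd v)
  set w := (regDeriv B s v).inverse k with hw
  have e1 : (regDeriv B e u).inverse h - w =
      (regDeriv B e u).inverse (h - k + (regDeriv B s v - regDeriv B e u) w) := by
    apply h1.injective
    rw [h1.self_apply_inverse, map_sub, h1.self_apply_inverse, sub_apply, hw,
      h2.self_apply_inverse]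
    abel
  rw [e1]
  refine (hB.norm_inverse_le he (hd u) _).trans ?_
  gcongr
  refine (norm_add_le _ _).trans ?_
  gcongr
  refine (ContinuousLinearMap.le_opNorm _ _).trans ?_
  gcongr
  exact hB.norm_inverse_le hs (hd v) k

theorem continuousAt_newtonStep (hB : IsMonotoneOp B) (hd : Differentiable ℝ B) (g u : H)
    {e : ℝ} (he : 0 < e) : ContinuousAt (fun s => newtonStep B g s u) e := by
  refine tendsto_iff_norm_sub_tendsto_zero.2 ?_
  set k := residual B g u + e • u with hk
  have hbd : Tendsto (fun s : ℝ => (‖(s - e) • u‖ +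
      ‖(e - s) • ContinuousLinearMap.id ℝ H‖ * (‖k‖ / e)) / s) (𝓝 e) (𝓝 0) := by
    have : ContinuousAt (fun s : ℝ => (‖(s - e) • u‖ +
      ‖(e - s) • ContinuousLinearMap.id ℝ H‖ * (‖k‖ / e)) / s) e := by
      refine ContinuousAt.div ?_ continuousAt_id he.ne'
      fun_prop
    simpa [ContinuousAt] using this
  refine squeeze_zero' (Eventually.of_forall fun _ => norm_nonneg _) ?_ hbd
  filter_upwards [lt_mem_nhds he] with s hs
  have h := hB.norm_inverse_sub_inverse_le hd hs he u u (residual B g u + s • u) k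
  have e1 : residual B g u + s • u - k = (s - e) • u := by rw [hk]; module
  have e2 : regDeriv B e u - regDeriv B s u = (e - s) • ContinuousLinearMap.id ℝ H := by
    simp only [regDeriv]; module
  rwa [e1, e2] at h

/-- Boundedness and Lipschitz continuity of the Newton step on balls. -/
theorem exists_bound_lipschitz_newtonStep (hB : IsMonotoneOp B) (hC : IsC2loc B) (g c : H)
    {R m E : ℝ} (hR : 0 < R) (hm : 0 < m) :
    ∃ L K : ℝ, 0 ≤ K ∧ ∀ e ∈ Icc m E,
      (∀ u ∈ Metric.closedBall c R, ‖newtonStep B g e u‖ ≤ L) ∧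
      ∀ u ∈ Metric.closedBall c R, ∀ v ∈ Metric.closedBall c R,
        ‖newtonStep B g e u - newtonStep B g e v‖ ≤ K * ‖u - v‖ := by
  obtain ⟨M₀, hM₀⟩ := hC.bound_zero c R hR
  obtain ⟨M₁, hM₁⟩ := hC.bound_one c R hR
  obtain ⟨M₂, hM₂⟩ := hC.bound_two c R hR
  have hc : c ∈ Metric.closedBall c R := Metric.mem_closedBall_self hR.le
  have p₀ := (norm_nonneg _).trans (hM₀ c hc)
  have p₁ := (norm_nonneg _).trans (hM₁ c hc)
  have p₂ := (norm_nonneg (fderiv ℝ (fderiv ℝ B) c)).trans (hM₂ c hc)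
  rcases lt_or_ge E m with hE | hE
  · exact ⟨0, 0, le_rfl, fun e he => absurd (he.1.trans he.2) (not_le.2 hE)⟩
  have pE : 0 < E := hm.trans_le hE
  set C := M₀ + ‖g‖ + E * (‖c‖ + R) with hCdef
  have hbd : ∀ e ∈ Icc m E, ∀ u ∈ Metric.closedBall c R, ‖residual B g u + e • u‖ ≤ C := by
    intro e he u hu
    have he0 : 0 < e := hm.trans_le he.1
    have h1 : ‖u‖ ≤ ‖c‖ + R := by
      have := norm_le_norm_add_norm_sub' u c
      linarith [mem_closedBall_iff_norm.1 hu]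
    calc _ ≤ ‖B u - g‖ + ‖e • u‖ := norm_add_le _ _
      _ ≤ (‖B u‖ + ‖g‖) + e * ‖u‖ := by
        rw [norm_smul, Real.norm_of_nonneg he0.le]
        gcongr
        exact norm_sub_le _ _
      _ ≤ _ := by rw [hCdef]; gcongr; exacts [hM₀ u hu, he.2]
  refine ⟨C / m, (M₁ + E + M₂ * (C / m)) / m, by positivity, fun e he => ⟨fun u hu => ?_,
    fun u hu v hv => ?_⟩⟩
  · have he0 : 0 < e := hm.trans_le he.1
    refine (hB.norm_inverse_le he0 (hC.diff u) _).trans ?_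
    gcongr
    exacts [hbd e he u hu, he.1]
  · have he0 : 0 < e := hm.trans_le he.1
    refine (hB.norm_inverse_sub_inverse_le hC.diff he0 he0 u v _ _).trans ?_
    have h1 : ‖residual B g u + e • u - (residual B g v + e • v)‖ ≤ (M₁ + E) * ‖u - v‖ := by
      rw [residual_add_smul_sub]
      have e1 : B u + e • u - (B v + e • v) = (B u - B v) + e • (u - v) := by module
      rw [e1, add_mul]
      refine (norm_add_le _ _).trans ?_
      rw [norm_smul, Real.norm_of_nonneg he0.le]
      gcongr
      · exact (convex_closedBall c R).norm_image_sub_le_of_norm_fderiv_le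
          (fun x _ => hC.diff x) hM₁ hv hu
      · exact he.2
    have h2 : ‖regDeriv B e v - regDeriv B e u‖ ≤ M₂ * ‖u - v‖ := by
      rw [regDeriv, regDeriv, add_sub_add_right_eq_sub, norm_sub_rev]
      exact (convex_closedBall c R).norm_image_sub_le_of_norm_fderiv_le
          (fun x _ => hC.diff_fderiv x) hM₂ hv hu
    calc _ ≤ ((M₁ + E) * ‖u - v‖ + M₂ * ‖u - v‖ * (C / m)) / m := by
          gcongr
          exacts [hbd e he v hv, he.1, he.1]
      _ = _ := by ring

/-- The dissipation estimate of the Newton step towards the regularized solution. -/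
theorem inner_newtonStep_le (hB : IsMonotoneOp B) (hC : IsC2loc B) {s : Set H}
    (hs : Convex ℝ s) {M δ : ℝ} (hM : ∀ x ∈ s, ‖fderiv ℝ (fderiv ℝ B) x‖ ≤ M)
    {e : ℝ} (he : 0 < e) {u v : H} (hu : u ∈ s) (hv : v ∈ s)
    (hreg : residual B f v + e • v = 0) (hg : ‖g - f‖ ≤ δ) :
    inner ℝ (u - v) (-newtonStep B g e u) ≤
      -‖u - v‖ ^ 2 + ‖u - v‖ * ((M / 2 * ‖u - v‖ ^ 2 + δ) / e) := by
  have hinv := hB.isInvertible_regDeriv he (hC.diff u)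
  set r := B v - B u - fderiv ℝ B u (v - u) + (g - f) with hr
  -- Because `B v = f - e v`, Newton's method would hit `v` exactly but for the Taylor remainder and
  -- the data error collected in `r`.
  have e1 : -newtonStep B g e u = -(u - v) + (regDeriv B e u).inverse r := by
    apply hinv.injective
    rw [newtonStep, map_neg, hinv.self_apply_inverse, map_add (regDeriv B e u),
      hinv.self_apply_inverse, regDeriv_apply, hr, residual, apply_regularized hreg]
    simp only [map_neg, map_sub]
    module
  have hrn : ‖r‖ ≤ M / 2 * ‖u - v‖ ^ 2 + δ := by
    refine (norm_add_le _ _).trans (add_le_add ?_ hg)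
    rw [norm_sub_rev u v]
    exact norm_taylor_two_le hC.diff hC.diff_fderiv hs hM hu hv
  rw [e1, inner_add_right, inner_neg_right, real_inner_self_eq_norm_sq]
  gcongr
  refine (real_inner_le_norm _ _).trans ?_
  gcongr
  exact (hB.norm_inverse_le he (hC.diff u) r).trans (by gcongr)

end VectorField

/-! ### Barriers for the distance to the path -/

section Barrier

variable {H : Type*} [NormedAddCommGroup H] [InnerProductSpace ℝ H] [CompleteSpace H]
  {B : H → H} {f g y u₀ : H} {ρ M c₁ c₀ b δ T : ℝ} {V : ℝ → H} {u u' : ℝ → H}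

/-- A barrier principle for the distance between a trajectory and the regularized path. -/
theorem norm_sub_regularized_le_barrier (hB : IsMonotoneOp B) (hC : IsC2loc B)
    (hA : Admissible B u₀ ρ M c₁ c₀ b) (hy : residual B f y = 0) (hρ : ‖y‖ + ‖u₀‖ ≤ ρ)
    (hV : ∀ e, 0 < e → residual B f (V e) + e • V e = 0) (hg : ‖g - f‖ ≤ δ)
    (hu₀ : u 0 = u₀) (hu : ∀ t ∈ Icc 0 T, HasDerivWithinAt u (u' t) (Icc 0 T) t)
    (hu' : ∀ t ∈ Icc 0 T, u t ∈ Metric.closedBall u₀ (3 * ρ) →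
      u' t = Phi (residual B g) (eps c₁ c₀ b) t (u t))
    {β β' : ℝ → ℝ} (hβ : ∀ t ∈ Icc 0 T, HasDerivAt β (β' t) t)
    (hβ0 : ∀ t ∈ Icc 0 T, 0 < β t) (hβρ : ∀ t ∈ Icc 0 T, ‖u t - V (eps c₁ c₀ b t)‖ = β t →
      β t ≤ 2 * ρ) (hinit : ‖y‖ + ‖u₀‖ ≤ β 0)
    (hbar : ∀ t ∈ Icc 0 T, ‖u t - V (eps c₁ c₀ b t)‖ = β t →
      -β t + (M / 2 * β t ^ 2 + δ) / eps c₁ c₀ b t + b / (c₀ + t) * ‖y‖ < β' t) :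
    ∀ t ∈ Icc 0 T, ‖u t - V (eps c₁ c₀ b t)‖ ≤ β t := by
  rcases lt_or_ge T 0 with hT | hT
  · intro t ht; exact absurd (ht.1.trans ht.2) (not_le.2 hT)
  set ε := eps c₁ c₀ b with hε
  have hεpos : ∀ t, 0 ≤ t → 0 < ε t := fun t ht => eps_pos hA.c₁_pos hA.c₀_pos ht
  set V' : ℝ → H := fun t =>
    (-(b / (c₀ + t) * ε t)) • (-((regDeriv B (ε t) (V (ε t))).inverse (V (ε t)))) with hV'
  have hVy : ∀ t, 0 ≤ t → ‖V (ε t)‖ ≤ ‖y‖ := fun t ht =>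
    norm_regularized_le hB (hεpos t ht) (hV _ (hεpos t ht)) hy
  have hVder : ∀ t, 0 ≤ t → HasDerivAt (fun t => V (ε t)) (V' t) t := fun t ht =>
    (hasDerivAt_regularized hB hC.diff hV (hεpos t ht)).scomp t (hasDerivAt_eps hA.c₀_pos ht)
  -- The factor `ε` in the derivative of `ε` cancels the `1 / ε` of the inverse.
  have hV'n : ∀ t, 0 ≤ t → ‖V' t‖ ≤ b / (c₀ + t) * ‖y‖ := fun t ht => by
    have hr := hA.rate_nonneg ht
    have he := hεpos t ht
    rw [hV', norm_smul, norm_neg, norm_neg, norm_mul, Real.norm_of_nonneg hr,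
      Real.norm_of_nonneg he.le, mul_assoc]
    gcongr
    exact (hB.mul_norm_inverse_le he (hC.diff _) _).trans (hVy t ht)
  have hder : ∀ t ∈ Icc 0 T, HasDerivWithinAt (fun t => ‖u t - V (ε t)‖ ^ 2)
      (2 * inner ℝ (u t - V (ε t)) (u' t - V' t)) (Icc 0 T) t := fun t ht =>
    ((hu t ht).fun_sub (hVder t ht.1).hasDerivWithinAt).norm_sq
  have hβsq : ∀ t ∈ Icc 0 T, HasDerivAt (fun t => β t ^ 2) (2 * (β t * β' t)) t := fun t ht => by
    refine ((hβ t ht).fun_pow 2).congr_deriv ?_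
    push_cast; ring
  -- Squares avoid the nondifferentiability of the norm at `0`. The strict inequality is needed only
  -- at contact times, and there `β t ≤ 2 ρ` places `u t` in the ball where `u'` is the Newton field
  -- and `M` bounds `B''`.
  have key := image_le_of_liminf_slope_right_lt_deriv_boundary' (a := 0) (b := T)
    (f := fun t => ‖u t - V (ε t)‖ ^ 2)
    (f' := fun t => 2 * inner ℝ (u t - V (ε t)) (u' t - V' t))
    (fun t ht => (hder t ht).continuousWithinAt)
    (fun t ht r hr => by
      have h1 := hder t (Ico_subset_Icc_self ht)
      have h2 : HasDerivWithinAt (fun t => ‖u t - V (ε t)‖ ^ 2)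
          (2 * inner ℝ (u t - V (ε t)) (u' t - V' t)) (Ici t) t :=
        h1.mono_of_mem_nhdsWithin (mem_of_superset (Icc_mem_nhdsGE ht.2)
          (Icc_subset_Icc_left ht.1))
      exact h2.liminf_right_slope_le hr)
    (B := fun t => β t ^ 2) (B' := fun t => 2 * (β t * β' t))
    (by
      have h0 := hVy 0 le_rfl
      have : ‖u 0 - V (ε 0)‖ ≤ β 0 := by
        rw [hu₀]
        linarith [norm_sub_le u₀ (V (ε 0))]
      gcongr)
    (fun t ht => (hβsq t ht).continuousAt.continuousWithinAt)
    (fun t ht => (hβsq t (Ico_subset_Icc_self ht)).hasDerivWithinAt)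
    (fun t ht heq => by
      have ht := Ico_subset_Icc_self ht
      have hpos := hβ0 t ht
      have hn : ‖u t - V (ε t)‖ = β t :=
        (pow_left_inj₀ (norm_nonneg _) hpos.le two_ne_zero).1 heq
      have hVball : ‖V (ε t) - u₀‖ ≤ ρ := by
        linarith [norm_sub_le (V (ε t)) u₀, hVy t ht.1]
      have hρ0 : 0 ≤ ρ := (norm_nonneg _).trans hVball
      have hm : u t ∈ Metric.closedBall u₀ (3 * ρ) := by
        rw [mem_closedBall_iff_norm]
        have := norm_sub_le_norm_sub_add_norm_sub (u t) (V (ε t)) u₀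
        linarith [hβρ t ht hn]
      have hVm : V (ε t) ∈ Metric.closedBall u₀ (3 * ρ) := by
        rw [mem_closedBall_iff_norm]; linarith
      have he := hεpos t ht.1
      have h1 := inner_newtonStep_le (g := g) hB hC (convex_closedBall u₀ (3 * ρ)) hA.M_bound
        he hm hVm (hV _ he) hg
      have h2 : -inner ℝ (u t - V (ε t)) (V' t) ≤ β t * (b / (c₀ + t) * ‖y‖) := by
        refine (neg_le_abs _).trans ((abs_real_inner_le_norm _ _).trans ?_)
        rw [hn]
        gcongr
        exact hV'n t ht.1
      rw [hu' t ht hm, Phi_residual, inner_sub_right]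
      rw [hn] at h1
      have h3 := mul_lt_mul_of_pos_left (hbar t ht hn) hpos
      have h4 : β t * (-β t + (M / 2 * β t ^ 2 + δ) / ε t + b / (c₀ + t) * ‖y‖) =
        -β t ^ 2 + β t * ((M / 2 * β t ^ 2 + δ) / ε t) + β t * (b / (c₀ + t) * ‖y‖) := by ring
      linarith)
  intro t ht
  exact (pow_le_pow_iff_left₀ (norm_nonneg _) (hβ0 t ht).le two_ne_zero).1 (key ht)

/-- In units of `x = ε / (16 M)`, the barrier is `4x`, the quadratic term `x/2`, noise and drift at
most `x` each, and the barrier falls at rate at most `x`. The inequality is `-4x + x/2 + x + x <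
-x`. -/
theorem norm_sub_regularized_le (hB : IsMonotoneOp B) (hC : IsC2loc B)
    (hA : Admissible B u₀ ρ M c₁ c₀ b) (hy : residual B f y = 0) (hρ : ‖y‖ + ‖u₀‖ ≤ ρ)
    (hV : ∀ e, 0 < e → residual B f (V e) + e • V e = 0) (hg : ‖g - f‖ ≤ δ)
    (hδ : ∀ t ∈ Icc 0 T, 16 * M * δ ≤ eps c₁ c₀ b t ^ 2)
    (hu₀ : u 0 = u₀) (hu : ∀ t ∈ Icc 0 T, HasDerivWithinAt u (u' t) (Icc 0 T) t)
    (hu' : ∀ t ∈ Icc 0 T, u t ∈ Metric.closedBall u₀ (3 * ρ) →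
      u' t = Phi (residual B g) (eps c₁ c₀ b) t (u t)) :
    ∀ t ∈ Icc 0 T, ‖u t - V (eps c₁ c₀ b t)‖ ≤ eps c₁ c₀ b t / (4 * M) := by
  have hM := hA.M_pos
  have hρ0 : 0 ≤ ρ := by linarith [norm_nonneg y, norm_nonneg u₀]
  have hpos : ∀ t ∈ Icc 0 T, 0 < eps c₁ c₀ b t := fun t ht =>
    eps_pos hA.c₁_pos hA.c₀_pos ht.1
  have h0 : eps c₁ c₀ b 0 / (4 * M) = ρ := by rw [hA.eps_zero]; field_simp
  refine norm_sub_regularized_le_barrier hB hC hA hy hρ hV hg hu₀ hu hu'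
    (β := fun t => eps c₁ c₀ b t / (4 * M))
    (fun t ht => (hasDerivAt_eps hA.c₀_pos ht.1).div_const (4 * M))
    (fun t ht => by have := hpos t ht; positivity) (fun t ht _ => ?_) (by rw [h0]; exact hρ)
    fun t ht _ => ?_
  · have h1 := (eps_strictAntiOn hA.c₁_pos hA.c₀_pos hA.b_pos).antitoneOn
      (mem_Ici.2 le_rfl) (mem_Ici.2 ht.1) ht.1
    have h2 : eps c₁ c₀ b t / (4 * M) ≤ eps c₁ c₀ b 0 / (4 * M) := by gcongr
    linarith
  · have he := hpos t ht
    set e := eps c₁ c₀ b t with hedef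
    have hr := hA.rate_le ht.1
    have hrm : b / (c₀ + t) * ‖y‖ ≤ e / (16 * M) := by
      refine le_trans ?_ (hA.rate_mul_le hρ0 ht.1)
      have := hA.rate_nonneg ht.1
      gcongr
      linarith [norm_nonneg u₀]
    have hd : δ / e ≤ e / (16 * M) := by
      rw [div_le_div_iff₀ he (by positivity)]
      linarith [hδ t ht]
    have h1 : (M / 2 * (e / (4 * M)) ^ 2 + δ) / e = e / (16 * M) / 2 + δ / e := by
      field_simp; ring
    have h2 : e / (4 * M) = 4 * (e / (16 * M)) := by field_simp; ring
    have h3 : -(b / (c₀ + t) * e) / (4 * M) = -(b / (c₀ + t) * (e / (4 * M))) := by ring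
    rw [h1, h3, h2]
    have hx : 0 < e / (16 * M) := by positivity
    nlinarith

theorem norm_sub_regularized_le_init (hB : IsMonotoneOp B) (hC : IsC2loc B)
    (hA : Admissible B u₀ ρ M c₁ c₀ b) (hy : residual B f y = 0) (hρ : ‖y‖ + ‖u₀‖ ≤ ρ)
    (hV : ∀ e, 0 < e → residual B f (V e) + e • V e = 0)
    (hu₀ : u 0 = u₀) (hu : ∀ t ∈ Icc 0 T, HasDerivWithinAt u
      (Phi (residual B f) (eps c₁ c₀ b) t (u t)) (Icc 0 T) t) :
    ∀ t ∈ Icc 0 T, ‖u t - V (eps c₁ c₀ b t)‖ ≤ ‖y‖ + ‖u₀‖ := by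
  intro t ht
  -- The margin `η` keeps the constant barrier positive even if `y = u₀ = 0`.
  refine le_of_forall_pos_le_add fun η hη => ?_
  have hM := hA.M_pos
  have hg : ‖f - f‖ ≤ (0 : ℝ) := by simp
  have hle := norm_sub_regularized_le hB hC hA hy hρ hV hg
    (fun t _ => by rw [mul_zero]; positivity) hu₀ hu fun _ _ _ => rfl
  refine norm_sub_regularized_le_barrier hB hC hA hy hρ hV hg hu₀ hu (fun _ _ _ => rfl)
    (β := fun _ => ‖y‖ + ‖u₀‖ + η) (β' := fun _ => 0) (fun t _ => hasDerivAt_const t _)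
    (fun _ _ => by positivity) (fun s hs heq => ?_) (by linarith) (fun s hs heq => ?_) t ht
  · rw [← heq]
    refine (hle s hs).trans ?_
    have h1 := (eps_strictAntiOn hA.c₁_pos hA.c₀_pos hA.b_pos).antitoneOn
      (mem_Ici.2 le_rfl) (mem_Ici.2 hs.1) hs.1
    have h0 : eps c₁ c₀ b 0 / (4 * M) = ρ := by rw [hA.eps_zero]; field_simp
    have h2 : eps c₁ c₀ b s / (4 * M) ≤ eps c₁ c₀ b 0 / (4 * M) := by gcongr
    linarith [norm_nonneg y, norm_nonneg u₀]
  · have h1 := hle s hs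
    rw [heq] at h1
    have he : 0 < eps c₁ c₀ b s := eps_pos hA.c₁_pos hA.c₀_pos hs.1
    set β := ‖y‖ + ‖u₀‖ + η with hβ
    have hβ0 : 0 < β := by positivity
    -- At contact the first barrier gives `M β ≤ ε / 4`, so the right side is at most `-β + β/8 +
    -- β/4 < 0`.
    have h2 : (M / 2 * β ^ 2 + 0) / eps c₁ c₀ b s ≤ β / 8 := by
      rw [div_le_iff₀ he]
      rw [le_div_iff₀ (by positivity)] at h1
      nlinarith
    have h3 : b / (c₀ + s) * ‖y‖ ≤ 1 / 4 * ‖y‖ := by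
      have := hA.rate_le hs.1
      gcongr
    linarith [norm_nonneg y, norm_nonneg u₀]

end Barrier

end DSM

end

namespace DSM

/-! ### Existence and uniqueness of trajectories -/

section Cauchy

variable {H : Type*} [NormedAddCommGroup H] [InnerProductSpace ℝ H]
  {B : H → H} {f g y u₀ : H} {ρ M c₁ c₀ b δ T : ℝ} {V : ℝ → H} {u v : ℝ → H}

theorem mem_closedBall_of_norm_sub_regularized_le (hB : IsMonotoneOp B)
    (hA : Admissible B u₀ ρ M c₁ c₀ b) (hy : residual B f y = 0) (hρ : ‖y‖ + ‖u₀‖ ≤ ρ)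
    (hV : ∀ e, 0 < e → residual B f (V e) + e • V e = 0) {t : ℝ} (ht : 0 ≤ t) {x : H}
    (hx : ‖x - V (eps c₁ c₀ b t)‖ ≤ eps c₁ c₀ b t / (4 * M)) :
    x ∈ Metric.closedBall u₀ (3 * ρ) := by
  have hM := hA.M_pos
  have he : 0 < eps c₁ c₀ b t := eps_pos hA.c₁_pos hA.c₀_pos ht
  have h0 : eps c₁ c₀ b 0 / (4 * M) = ρ := by rw [hA.eps_zero]; field_simp
  have h1 := (eps_strictAntiOn hA.c₁_pos hA.c₀_pos hA.b_pos).antitoneOn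
    (mem_Ici.2 le_rfl) (mem_Ici.2 ht) ht
  have h2 : eps c₁ c₀ b t / (4 * M) ≤ eps c₁ c₀ b 0 / (4 * M) := by gcongr
  have h3 := norm_regularized_le hB he (hV _ he) hy
  rw [mem_closedBall_iff_norm]
  have h4 := norm_sub_le_norm_sub_add_norm_sub x (V (eps c₁ c₀ b t)) u₀
  have h5 := norm_sub_le (V (eps c₁ c₀ b t)) u₀
  linarith [norm_nonneg y, norm_nonneg u₀]

theorem eps_mem_Icc (hA : Admissible B u₀ ρ M c₁ c₀ b) {t : ℝ} (ht : t ∈ Icc 0 T) :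
    eps c₁ c₀ b t ∈ Icc (eps c₁ c₀ b T) (eps c₁ c₀ b 0) := by
  have h := (eps_strictAntiOn hA.c₁_pos hA.c₀_pos hA.b_pos).antitoneOn
  exact ⟨h (mem_Ici.2 ht.1) (mem_Ici.2 (ht.1.trans ht.2)) ht.2,
    h (mem_Ici.2 le_rfl) (mem_Ici.2 ht.1) ht.1⟩

theorem IsSolutionOn.mono {F : H → H} {ε : ℝ → ℝ} {I J : Set ℝ}
    (hu : IsSolutionOn F ε u₀ I u) (hJ : J ⊆ I) : IsSolutionOn F ε u₀ J u :=
  ⟨hu.1, fun t ht => (hu.2 t (hJ ht)).mono hJ⟩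

variable [CompleteSpace H]

/-- Existence on a compact time interval, by cutting off the vector field outside a ball which the
trajectory cannot leave. -/
theorem exists_isSolutionOn_Icc (hB : IsMonotoneOp B) (hC : IsC2loc B) (hρ0 : 0 < ρ)
    (hA : Admissible B u₀ ρ M c₁ c₀ b) (hy : residual B f y = 0) (hρ : ‖y‖ + ‖u₀‖ ≤ ρ)
    (hV : ∀ e, 0 < e → residual B f (V e) + e • V e = 0) (hg : ‖g - f‖ ≤ δ) (hT : 0 ≤ T)
    (hδ : ∀ t ∈ Icc 0 T, 16 * M * δ ≤ eps c₁ c₀ b t ^ 2) :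
    ∃ u : ℝ → H, IsSolutionOn (residual B g) (eps c₁ c₀ b) u₀ (Icc 0 T) u := by
  have hR : 0 < 3 * ρ := by linarith
  obtain ⟨P, hPlip, hPmem, hPid⟩ := exists_lipschitz_retraction_closedBall u₀ hR
  obtain ⟨L, K, hK, hLK⟩ := exists_bound_lipschitz_newtonStep (E := eps c₁ c₀ b 0) hB hC g u₀ hR
    (eps_pos (b := b) hA.c₁_pos hA.c₀_pos hT)
  obtain ⟨u, hu0, hu⟩ := exists_solution_of_bounded_lipschitz
    (g := fun t x => -newtonStep B g (eps c₁ c₀ b t) (P x)) (T := T) (L := L) (K := K * 2) hT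
    (fun t ht x z => by
      rw [neg_sub_neg, norm_sub_rev, mul_assoc]
      refine ((hLK _ (eps_mem_Icc hA ht)).2 _ (hPmem x) _ (hPmem z)).trans ?_
      gcongr
      simpa [dist_eq_norm] using hPlip.dist_le_mul x z)
    (fun x t ht => by
      have h := (continuousAt_newtonStep hB hC.diff g (P x)
        (eps_pos (b := b) hA.c₁_pos hA.c₀_pos ht.1)).comp
        (hasDerivAt_eps hA.c₀_pos ht.1).continuousAt
      exact h.neg.continuousWithinAt)
    (fun t ht x => by
      rw [norm_neg]
      exact (hLK _ (eps_mem_Icc hA ht)).1 _ (hPmem x)) u₀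
  refine ⟨u, hu0, fun t ht => ?_⟩
  -- The barrier bound asks for the true field only inside the ball, where `P` is the identity. It
  -- therefore applies to the cut-off trajectory and shows that the cut-off never acts.
  have hle := norm_sub_regularized_le hB hC hA hy hρ hV hg hδ hu0 hu
    (fun t _ hm => by rw [hPid _ hm, Phi_residual]) t ht
  have hm := mem_closedBall_of_norm_sub_regularized_le hB hA hy hρ hV ht.1 hle
  have h := hu t ht
  rwa [hPid _ hm, ← Phi_residual] at h

theorem IsSolutionOn.eqOn_Icc (hB : IsMonotoneOp B) (hC : IsC2loc B) (hρ0 : 0 < ρ)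
    (hA : Admissible B u₀ ρ M c₁ c₀ b) (hy : residual B f y = 0) (hρ : ‖y‖ + ‖u₀‖ ≤ ρ)
    (hV : ∀ e, 0 < e → residual B f (V e) + e • V e = 0) (hT : 0 ≤ T)
    (hu : IsSolutionOn (residual B f) (eps c₁ c₀ b) u₀ (Icc 0 T) u)
    (hv : IsSolutionOn (residual B f) (eps c₁ c₀ b) u₀ (Icc 0 T) v) :
    EqOn u v (Icc 0 T) := by
  have hR : 0 < 3 * ρ := by linarith
  obtain ⟨L, K, hK, hLK⟩ := exists_bound_lipschitz_newtonStep (E := eps c₁ c₀ b 0) hB hC f u₀ hR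
    (eps_pos (b := b) hA.c₁_pos hA.c₀_pos hT)
  have hmem : ∀ w, IsSolutionOn (residual B f) (eps c₁ c₀ b) u₀ (Icc 0 T) w →
      ∀ t ∈ Icc 0 T, w t ∈ Metric.closedBall u₀ (3 * ρ) := fun w hw t ht =>
    mem_closedBall_of_norm_sub_regularized_le hB hA hy hρ hV ht.1
      (norm_sub_regularized_le (δ := 0) hB hC hA hy hρ hV (by simp)
        (fun t _ => by rw [mul_zero]; positivity) hw.1 hw.2 (fun _ _ _ => rfl) t ht)
  have hIci : ∀ w, IsSolutionOn (residual B f) (eps c₁ c₀ b) u₀ (Icc 0 T) w →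
      ∀ t ∈ Ico 0 T, HasDerivWithinAt w (Phi (residual B f) (eps c₁ c₀ b) t (w t)) (Ici t) t :=
    fun w hw t ht => (hw.2 t (Ico_subset_Icc_self ht)).mono_of_mem_nhdsWithin
      (mem_of_superset (Icc_mem_nhdsGE ht.2) (Icc_subset_Icc_left ht.1))
  refine ODE_solution_unique_of_mem_Icc_right
    (v := fun t x => Phi (residual B f) (eps c₁ c₀ b) t x)
    (s := fun _ => Metric.closedBall u₀ (3 * ρ)) (K := ⟨K, hK⟩) (fun t ht => ?_)
    (fun t ht => (hu.2 t ht).continuousWithinAt) (hIci u hu)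
    (fun t ht => hmem u hu t (Ico_subset_Icc_self ht))
    (fun t ht => (hv.2 t ht).continuousWithinAt) (hIci v hv)
    (fun t ht => hmem v hv t (Ico_subset_Icc_self ht)) (hu.1.trans hv.1.symm)
  refine LipschitzOnWith.of_dist_le_mul fun x hx z hz => ?_
  rw [dist_eq_norm, dist_eq_norm, Phi_residual, Phi_residual, neg_sub_neg, norm_sub_rev]
  exact (hLK _ (eps_mem_Icc hA (Ico_subset_Icc_self ht))).2 _ hx _ hz

/-- Existence and uniqueness on the half line. -/
theorem exists_unique_isSolutionOn_Ici (hB : IsMonotoneOp B) (hC : IsC2loc B) (hρ0 : 0 < ρ)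
    (hA : Admissible B u₀ ρ M c₁ c₀ b) (hy : residual B f y = 0) (hρ : ‖y‖ + ‖u₀‖ ≤ ρ)
    (hV : ∀ e, 0 < e → residual B f (V e) + e • V e = 0) :
    ∃ u : ℝ → H, IsSolutionOn (residual B f) (eps c₁ c₀ b) u₀ (Ici 0) u ∧
      ∀ v : ℝ → H, IsSolutionOn (residual B f) (eps c₁ c₀ b) u₀ (Ici 0) v →
        EqOn v u (Ici 0) := by
  have hex : ∀ n : ℕ, ∃ w : ℝ → H,
      IsSolutionOn (residual B f) (eps c₁ c₀ b) u₀ (Icc 0 (n : ℝ)) w := fun n =>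
    exists_isSolutionOn_Icc (δ := 0) hB hC hρ0 hA hy hρ hV (by simp) n.cast_nonneg
      (fun t _ => by rw [mul_zero]; positivity)
  choose w hw using hex
  have hagree : ∀ m n : ℕ, m ≤ n → ∀ t ∈ Icc 0 (m : ℝ), w m t = w n t := fun m n hmn =>
    (hw m).eqOn_Icc hB hC hρ0 hA hy hρ hV m.cast_nonneg
      ((hw n).mono (Icc_subset_Icc_right (Nat.cast_le.2 hmn)))
  -- The index strictly exceeds `t`. Strictness matters: `Icc 0 n` is a neighbourhood of `t` in `Ici
  -- 0` when `t < n`.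
  set u : ℝ → H := fun t => w (⌊t⌋₊ + 1) t with hu
  have huw : ∀ n : ℕ, ∀ t : ℝ, 0 ≤ t → t < n → u t = w n t := fun n t h0 hn => by
    refine hagree _ _ ((Nat.floor_lt h0).2 hn) t ⟨h0, ?_⟩
    push_cast
    exact (Nat.lt_floor_add_one t).le
  have hsol : IsSolutionOn (residual B f) (eps c₁ c₀ b) u₀ (Ici 0) u := by
    refine ⟨(hw _).1, fun t ht => ?_⟩
    have ht : 0 ≤ t := ht
    obtain ⟨n, hn⟩ := exists_nat_gt t
    rw [huw n t ht hn]
    have h1 : HasDerivWithinAt (w n) (Phi (residual B f) (eps c₁ c₀ b) t (w n t)) (Ici 0) t := by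
      refine ((hw n).2 t ⟨ht, hn.le⟩).mono_of_mem_nhdsWithin ?_
      filter_upwards [self_mem_nhdsWithin, mem_nhdsWithin_of_mem_nhds (gt_mem_nhds hn)]
        with s hs hsn
      exact ⟨hs, hsn.le⟩
    refine h1.congr_of_eventuallyEq ?_ (huw n t ht hn)
    filter_upwards [self_mem_nhdsWithin, mem_nhdsWithin_of_mem_nhds (gt_mem_nhds hn)]
      with s hs hsn
    exact huw n s hs hsn
  refine ⟨u, hsol, fun v hv t ht => ?_⟩
  have ht : 0 ≤ t := ht
  have hsub : Icc 0 t ⊆ Ici 0 := fun s hs => hs.1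
  exact (hv.mono hsub).eqOn_Icc hB hC hρ0 hA hy hρ hV ht (hsol.mono hsub) ⟨ht, le_rfl⟩

end Cauchy

/-! ### Choice of constants and stopping time -/

section Constants

variable {H : Type*} [NormedAddCommGroup H] [InnerProductSpace ℝ H]
  {B : H → H} {u₀ : H} {ρ M c₁ c₀ b : ℝ}

theorem exists_admissible (hC : IsC2loc B) (u₀ : H) (hρ : 0 < ρ) :
    ∃ M c₁ c₀ b : ℝ, Admissible B u₀ ρ M c₁ c₀ b := by
  obtain ⟨M₂, hM₂⟩ := hC.bound_two u₀ (3 * ρ) (by linarith)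
  set M := max M₂ 1 with hMdef
  have hM : 0 < M := lt_max_of_lt_right one_pos
  have h2 : (0 : ℝ) < 2 ^ (1 / 2 : ℝ) := by positivity
  have hc₁ : 0 < 4 * M * ρ * 2 ^ (1 / 2 : ℝ) := by positivity
  -- With `b = 1/2` and `c₀ = 2` the logarithmic rate starts at exactly `1/4`; `c₁` then normalizes
  -- `ε(0)`.
  refine ⟨M, 4 * M * ρ * 2 ^ (1 / 2 : ℝ), 2, 1 / 2,
    { M_pos := hM
      M_bound := fun u hu => (hM₂ u hu).trans (le_max_left _ _)
      c₁_pos := hc₁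
      c₀_pos := two_pos
      b_pos := by norm_num
      b_lt_one := by norm_num
      log_deriv := fun t ht => ?_
      eps_zero := ?_ }⟩
  · have he := eps_pos (b := 1 / 2) hc₁ two_pos ht
    have hp : 0 < 1 / 2 / (2 + t) := by positivity
    rw [(hasDerivAt_eps two_pos ht).deriv, abs_neg, abs_mul, abs_of_pos he, abs_of_pos hp,
      mul_div_assoc, div_self he.ne', mul_one, div_le_iff₀ (by linarith)]
    linarith
  · rw [eps, add_zero, Real.rpow_neg two_pos.le, mul_assoc, mul_inv_cancel₀ h2.ne', mul_one]

/-- The stopping rule `ε(t)² = 16 M δ`. -/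
theorem exists_stopping_time (h₁ : 0 < c₁) (h₀ : 0 < c₀) (hb : 0 < b) (hM : 0 < M) :
    ∃ τ : ℝ → ℝ,
      (∀ δ ∈ Ioc 0 (eps c₁ c₀ b 0 ^ 2 / (16 * M)),
        0 ≤ τ δ ∧ eps c₁ c₀ b (τ δ) ^ 2 = 16 * M * δ ∧
        ∀ t : ℝ, 0 ≤ t → eps c₁ c₀ b t ^ 2 = 16 * M * δ → t = τ δ) ∧
      Tendsto τ (𝓝[>] 0) atTop := by
  have hanti := eps_strictAntiOn h₁ h₀ hb
  have hlim := (tendsto_eps h₁ h₀ hb).mono_right nhdsWithin_le_nhds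
  have hex : ∀ δ : ℝ, ∃ s : ℝ, δ ∈ Ioc 0 (eps c₁ c₀ b 0 ^ 2 / (16 * M)) →
      0 ≤ s ∧ eps c₁ c₀ b s ^ 2 = 16 * M * δ := by
    intro δ
    by_cases hδ : δ ∈ Ioc 0 (eps c₁ c₀ b 0 ^ 2 / (16 * M))
    · have hpos : 0 < 16 * M * δ := by have := hδ.1; positivity
      obtain ⟨T, hT0, hT⟩ := ((eventually_ge_atTop 0).and
        ((hlim.pow 2).eventually (gt_mem_nhds (by simpa using hpos)))).exists
      have hcont : ContinuousOn (fun t => eps c₁ c₀ b t ^ 2) (Icc 0 T) := fun t ht =>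
        ((hasDerivAt_eps h₀ ht.1).continuousAt.pow 2).continuousWithinAt
      have h2 := hδ.2
      rw [le_div_iff₀ (by positivity)] at h2
      obtain ⟨s, hs, hs'⟩ := intermediate_value_Icc' hT0 hcont ⟨hT.le, by linarith⟩
      exact ⟨s, fun _ => ⟨hs.1, hs'⟩⟩
    · exact ⟨0, fun h => absurd h hδ⟩
  choose τ hτ using hex
  refine ⟨τ, fun δ hδ => ⟨(hτ δ hδ).1, (hτ δ hδ).2, fun t ht h => ?_⟩, ?_⟩
  · have h1 := eps_pos (b := b) h₁ h₀ ht
    have h2 := eps_pos (b := b) h₁ h₀ (hτ δ hδ).1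
    refine hanti.injOn (mem_Ici.2 ht) (mem_Ici.2 (hτ δ hδ).1) ?_
    exact (pow_left_inj₀ h1.le h2.le two_ne_zero).1 (h.trans (hτ δ hδ).2.symm)
  -- If `τ δ < A'`, then `16 M δ = ε(τ δ)² > ε(A')²`, which fails for small `δ`.
  · refine tendsto_atTop.2 fun A => ?_
    set A' := max A 0 with hA'
    have hA0 : 0 ≤ A' := le_max_right _ _
    have hp := eps_pos (b := b) h₁ h₀ hA0
    have hp0 := eps_pos (b := b) h₁ h₀ le_rfl
    filter_upwards [Ioc_mem_nhdsGT (show 0 < eps c₁ c₀ b 0 ^ 2 / (16 * M) by positivity),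
      Ioo_mem_nhdsGT (show 0 < eps c₁ c₀ b A' ^ 2 / (16 * M) by positivity)] with δ hδ hδ'
    refine (le_max_left A 0).trans ?_
    by_contra! hlt
    have h1 := hanti (mem_Ici.2 (hτ δ hδ).1) (mem_Ici.2 hA0) hlt
    have h2 := (lt_div_iff₀ (by positivity)).1 hδ'.2
    have h3 := (hτ δ hδ).2
    nlinarith

end Constants

end DSM

/-! ### Main theorem -/

theorem theorem1 {H : Type*} [NormedAddCommGroup H] [InnerProductSpace ℝ H] [CompleteSpace H]
    (B : H → H) (f : H) (hmono : DSM.IsMonotoneOp B) (hC2 : DSM.IsC2loc B)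
    (hN : ∃ z : H, DSM.residual B f z = 0) :
    ∃ y : H, DSM.IsMinNormZero (DSM.residual B f) y ∧
      (∀ y' : H, DSM.IsMinNormZero (DSM.residual B f) y' → y' = y) ∧
      -- the initial value is arbitrary; `ρ = ‖y‖ + ‖u₀‖` is allowed unless `y = u₀ = 0`
      ∀ u₀ : H, ∀ ρ : ℝ, 0 < ρ → ‖y‖ + ‖u₀‖ ≤ ρ →
        (∃ M c₁ c₀ b : ℝ, DSM.Admissible B u₀ ρ M c₁ c₀ b) ∧
        ∀ M c₁ c₀ b : ℝ, DSM.Admissible B u₀ ρ M c₁ c₀ b →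
          -- the vector field is well defined
          (∀ t : ℝ, 0 ≤ t → ∀ x : H,
            (DSM.regDeriv (DSM.residual B f) (DSM.eps c₁ c₀ b t) x).IsInvertible) ∧
          -- exact data: unique global solution, its location and its limit
          (∃ u : ℝ → H,
            DSM.IsSolutionOn (DSM.residual B f) (DSM.eps c₁ c₀ b) u₀ (Ici 0) u ∧
            (∀ v : ℝ → H,
              DSM.IsSolutionOn (DSM.residual B f) (DSM.eps c₁ c₀ b) u₀ (Ici 0) v →
                EqOn v u (Ici 0)) ∧
            (∀ t : ℝ, 0 ≤ t → u t ∈ Metric.closedBall u₀ (3 * (‖y‖ + ‖u₀‖))) ∧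
            Tendsto u atTop (𝓝 y)) ∧
          -- noisy data: the stopping rule
          (∃ τ : ℝ → ℝ,
            (∀ δ ∈ Ioc 0 (DSM.eps c₁ c₀ b 0 ^ 2 / (16 * M)),
              0 ≤ τ δ ∧ DSM.eps c₁ c₀ b (τ δ) ^ 2 = 16 * M * δ ∧
              ∀ t : ℝ, 0 ≤ t → DSM.eps c₁ c₀ b t ^ 2 = 16 * M * δ → t = τ δ) ∧
            Tendsto τ (𝓝[>] 0) atTop ∧
            ∀ fδ : ℝ → H,
              (∀ δ ∈ Ioc 0 (DSM.eps c₁ c₀ b 0 ^ 2 / (16 * M)), ‖fδ δ - f‖ ≤ δ) →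
              (∀ δ ∈ Ioc 0 (DSM.eps c₁ c₀ b 0 ^ 2 / (16 * M)), ∃ v : ℝ → H,
                DSM.IsSolutionOn (DSM.residual B (fδ δ)) (DSM.eps c₁ c₀ b) u₀
                  (Icc 0 (τ δ)) v) ∧
              ∀ uδ : ℝ → ℝ → H,
                (∀ δ ∈ Ioc 0 (DSM.eps c₁ c₀ b 0 ^ 2 / (16 * M)),
                  DSM.IsSolutionOn (DSM.residual B (fδ δ)) (DSM.eps c₁ c₀ b) u₀
                    (Icc 0 (τ δ)) (uδ δ)) →
                Tendsto (fun δ => uδ δ (τ δ)) (𝓝[>] 0) (𝓝 y)) := by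
  choose! V hV using fun e : ℝ => fun he : 0 < e =>
    DSM.exists_regularized_solution hmono hC2 he f
  obtain ⟨y, hVy, hmin, huniq⟩ := DSM.tendsto_regularized hmono hC2.diff.continuous hN hV
  have hy := hmin.1
  refine ⟨y, hmin, huniq, fun u₀ ρ hρ0 hρ => ⟨DSM.exists_admissible hC2 u₀ hρ0,
    fun M c₁ c₀ b hA => ?_⟩⟩
  have hM := hA.M_pos
  have hpos : ∀ t, 0 ≤ t → 0 < DSM.eps c₁ c₀ b t := fun t ht =>
    DSM.eps_pos hA.c₁_pos hA.c₀_pos ht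
  have hanti := (DSM.eps_strictAntiOn hA.c₁_pos hA.c₀_pos hA.b_pos).antitoneOn
  have hεlim := DSM.tendsto_eps hA.c₁_pos hA.c₀_pos hA.b_pos
  have hVlim : Tendsto (fun t => V (DSM.eps c₁ c₀ b t)) atTop (𝓝 y) := hVy.comp hεlim
  have hεlim' : Tendsto (fun t => DSM.eps c₁ c₀ b t / (4 * M)) atTop (𝓝 0) := by
    simpa using (hεlim.mono_right nhdsWithin_le_nhds).div_const (4 * M)
  refine ⟨fun t ht x => ?_, ?_, ?_⟩
  · rw [DSM.regDeriv_residual]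
    exact hmono.isInvertible_regDeriv (hpos t ht) (hC2.diff x)
  · obtain ⟨u, hu, hu'⟩ := DSM.exists_unique_isSolutionOn_Ici hmono hC2 hρ0 hA hy hρ hV
    have huI : ∀ T, DSM.IsSolutionOn (DSM.residual B f) (DSM.eps c₁ c₀ b) u₀ (Icc 0 T) u :=
      fun T => hu.mono fun s hs => hs.1
    refine ⟨u, hu, hu', fun t ht => ?_, ?_⟩
    · have h1 := DSM.norm_sub_regularized_le_init hmono hC2 hA hy hρ hV hu.1 (huI t).2 t
        ⟨ht, le_rfl⟩
      have h2 := DSM.norm_regularized_le hmono (hpos t ht) (hV _ (hpos t ht)) hy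
      have h3 := norm_sub_le_norm_sub_add_norm_sub (u t) (V (DSM.eps c₁ c₀ b t)) u₀
      have h4 := norm_sub_le (V (DSM.eps c₁ c₀ b t)) u₀
      rw [mem_closedBall_iff_norm]
      linarith [norm_nonneg y, norm_nonneg u₀]
    · have hdiff : Tendsto (fun t => u t - V (DSM.eps c₁ c₀ b t)) atTop (𝓝 0) := by
        refine squeeze_zero_norm' ?_ hεlim'
        filter_upwards [eventually_ge_atTop 0] with t ht
        exact DSM.norm_sub_regularized_le (δ := 0) hmono hC2 hA hy hρ hV (by simp)
          (fun t _ => by rw [mul_zero]; positivity) hu.1 (huI t).2 (fun _ _ _ => rfl) t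
          ⟨ht, le_rfl⟩
      simpa using hdiff.add hVlim
  · obtain ⟨τ, hτ, hτlim⟩ := DSM.exists_stopping_time hA.c₁_pos hA.c₀_pos hA.b_pos hM
    -- The stopping rule is the last moment at which the noise condition of the barrier holds, since
    -- `ε` decreases.
    have hδ : ∀ δ ∈ Ioc 0 (DSM.eps c₁ c₀ b 0 ^ 2 / (16 * M)), ∀ t ∈ Icc 0 (τ δ),
        16 * M * δ ≤ DSM.eps c₁ c₀ b t ^ 2 := fun δ hδ t ht => by
      rw [← (hτ δ hδ).2.1]
      have h1 := hpos _ (hτ δ hδ).1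
      have h2 := hanti (mem_Ici.2 ht.1) (mem_Ici.2 (hτ δ hδ).1) ht.2
      gcongr
    refine ⟨τ, hτ, hτlim, fun fδ hfδ => ⟨fun δ hd => ?_, fun uδ huδ => ?_⟩⟩
    · exact DSM.exists_isSolutionOn_Icc hmono hC2 hρ0 hA hy hρ hV (hfδ δ hd) (hτ δ hd).1
        (hδ δ hd)
    · have hdiff : Tendsto (fun δ => uδ δ (τ δ) - V (DSM.eps c₁ c₀ b (τ δ))) (𝓝[>] 0)
          (𝓝 0) := by
        refine squeeze_zero_norm' ?_ (hεlim'.comp hτlim)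
        have h0 := hpos 0 le_rfl
        filter_upwards [Ioc_mem_nhdsGT
          (show 0 < DSM.eps c₁ c₀ b 0 ^ 2 / (16 * M) by positivity)] with δ hd
        exact DSM.norm_sub_regularized_le hmono hC2 hA hy hρ hV (hfδ δ hd) (hδ δ hd)
          (huδ δ hd).1 (huδ δ hd).2 (fun _ _ _ => rfl) (τ δ) ⟨(hτ δ hd).1, le_rfl⟩
      simpa using hdiff.add (hVlim.comp hτlim)
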